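/- Let $X$ be a Tychonoff (i.e. completely regular Hausdorff) topological space. Let $CL(X)$ be the set of all nonempty closed subsets of $X$, and let $\tau_F$ be the Fell topology on $CL(X)$, that is, the topology having as a subbase the sets $U^-=\{A\in CL(X): A\cap U\neq\emptyset\}$ for $U\subset X$ nonempty open, together with the sets $(X\setminus K)^+=\{A\in CL(X): A\subset X\setminus K\}$ for $K\subsetneq X$ compact. Then the following are equivalent: 1. $(CL(X),\tau_F)$ is a Fréchet–Urysohn space (whenever a point $y$ lies in the closure of a set $S$, some sequence in $S$ converges to $y$) and has an $\omega^\omega$-base (every point $y$ has a neighborhood base $\{U_\alpha[y]:\alpha\in\omega^\omega\}$ such that $U_\beta[y]\subset U_\alpha[y]$ whenever $\alpha,\beta\in\omega^\omega$ satisfy $\alpha(n)\le\beta(n)$ for all $n$); 2. $(CL(X),\tau_F)$ is first-countable. -/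

import Mathlib

open Topology

/-- `CL(X)`: the type of nonempty closed subsets of `X`. -/
def CL (X : Type*) [TopologicalSpace X] : Type _ :=
  {A : Set X // A.Nonempty ∧ IsClosed A}

namespace CL

/-- `U⁻`: the nonempty closed sets that meet `U`. -/
def hit {X : Type*} [TopologicalSpace X] (U : Set X) : Set (CL X) :=
  {A | (A.1 ∩ U).Nonempty}

/-- `V⁺`: the nonempty closed sets contained in `V`. -/
def inside {X : Type*} [TopologicalSpace X] (V : Set X) : Set (CL X) :=
  {A | A.1 ⊆ V}

/-- The Fell topology on `CL(X)`: it has as a subbase the sets `U⁻` with `U` nonempty open and the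
sets `(Kᶜ)⁺` with `K ≠ X` compact. -/
instance fellTopology (X : Type*) [TopologicalSpace X] : TopologicalSpace (CL X) :=
  TopologicalSpace.generateFrom
    ({S | ∃ U : Set X, IsOpen U ∧ U.Nonempty ∧ S = hit U} ∪
      {S | ∃ K : Set X, IsCompact K ∧ K ≠ Set.univ ∧ S = inside Kᶜ})

end CL

/-- `Y` has an `ω^ω`-base: each point `y` has a neighborhood base `(U α)` indexed by the functions
`α : ℕ → ℕ` such that `U β ⊆ U α` whenever `α ≤ β` pointwise. -/
def HasOmegaOmegaBase (Y : Type*) [TopologicalSpace Y] : Prop :=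
  ∀ y : Y, ∃ U : (ℕ → ℕ) → Set Y,
    (𝓝 y).HasBasis (fun _ => True) U ∧ ∀ α β : ℕ → ℕ, α ≤ β → U β ⊆ U α

open Filter Set

/-! Let `F` have an `ω^ω`-base `U`. The sets `D` (intersections of `U β` over all `β` extending a
finite sequence) are countably many. If no `D (α|n)` is in `F`, a diagonal sequence tending to `F`
avoids sets `U (β n)` with `β n` extending `α|n`; one `γ` dominates all `β n`, a contradiction. So
such `D` generate `F`. The Fréchet–Urysohn property of `CL X` supplies the diagonal sequences, via
`exists_diagonal`, for the cocompact filter of `Aᶜ` and, when needed, for `𝓝 x`. Both are thus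
countably generated. With a countable dense subset of `A`, this gives a countable base at `A`. -/

/-- A filter with a monotone base indexed by `ℕ → ℕ` which is strongly Fréchet is countably
generated. -/
theorem Filter.isCountablyGenerated_of_omegaOmega_basis {Y : Type*} {F : Filter Y}
    {U : (ℕ → ℕ) → Set Y} (hU : F.HasBasis (fun _ => True) U)
    (hmono : ∀ α β : ℕ → ℕ, α ≤ β → U β ⊆ U α)
    (hF : ∀ S : ℕ → Set Y, Antitone S → (∀ n, ∃ᶠ y in F, y ∈ S n) →
      ∃ y : ℕ → Y, Tendsto y atTop F ∧ ∀ n, ∀ᶠ k in atTop, y k ∈ S n) :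
    F.IsCountablyGenerated := by
  let D : (Σ n : ℕ, (Fin n → ℕ)) → Set Y := fun p =>
    ⋂ (β : ℕ → ℕ) (_ : ∀ i : Fin p.1, β i = p.2 i), U β
  have key : ∀ α : ℕ → ℕ, ∃ n, D ⟨n, fun i => α i⟩ ∈ F := by
    intro α
    by_contra! hcon
    obtain ⟨y, hy, hyS⟩ := hF (fun n => (D ⟨n, fun i => α i⟩)ᶜ) (by
      intro m n hmn
      refine compl_subset_compl.2 fun z hz => ?_
      simp only [D, mem_iInter] at hz ⊢
      exact fun β hβ => hz β fun i => hβ ⟨i, i.2.trans_le hmn⟩) (fun n h => hcon n (by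
        filter_upwards [h] with z hz using not_not.1 hz))
    have h2 : ∀ n, ∃ k ≥ n, y k ∉ D ⟨n, fun i => α i⟩ := fun n =>
      ((hyS n).and (eventually_ge_atTop n)).exists.imp fun k hk => ⟨hk.2, hk.1⟩
    choose k hk hyk using h2
    simp only [D, mem_iInter, not_forall] at hyk
    choose β hβ hyβ using hyk
    -- The supremum is finite: `β n i = α i` once `n > i`, so only `n ≤ i` matter.
    let γ : ℕ → ℕ := fun i => max (α i) ((Finset.range (i + 1)).sup fun n => β n i)
    have hγ : ∀ n, β n ≤ γ := by
      intro n i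
      rcases lt_or_ge i n with h | h
      · exact (hβ n ⟨i, h⟩).le.trans (le_max_left _ _)
      · exact (Finset.le_sup (f := fun n => β n i)
          (Finset.mem_range.2 (Nat.lt_succ_of_le h))).trans (le_max_right _ _)
    obtain ⟨N, hN⟩ := eventually_atTop.1 (hy.eventually (hU.mem_of_mem (i := γ) trivial))
    exact hyβ N (hmono _ _ (hγ N) (hN _ (hk N)))
  refine ⟨range D ∩ {T | T ∈ F}, (countable_range D).mono inter_subset_left, ?_⟩
  refine le_antisymm (le_generate_iff.2 fun T hT => hT.2) fun T hT => ?_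
  obtain ⟨α, -, hα⟩ := hU.mem_iff.1 hT
  obtain ⟨n, hn⟩ := key α
  refine mem_of_superset (mem_generate_of_mem ⟨mem_range_self _, hn⟩) fun z hz => hα ?_
  simp only [D, mem_iInter] at hz
  exact hz α fun _ => rfl

theorem FirstCountableTopology.hasOmegaOmegaBase (Y : Type*) [TopologicalSpace Y]
    [FirstCountableTopology Y] : HasOmegaOmegaBase Y := by
  intro y
  obtain ⟨V, hV⟩ := (𝓝 y).exists_antitone_basis
  refine ⟨fun α => V (α 0), ⟨fun T => ?_⟩, fun α β h => hV.antitone (h 0)⟩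
  rw [hV.mem_iff]
  exact ⟨fun ⟨n, hn⟩ => ⟨fun _ => n, trivial, hn⟩, fun ⟨α, _, h⟩ => ⟨α 0, h⟩⟩

namespace CL

variable {X : Type*} [TopologicalSpace X]

theorem tendsto_nhds_iff {ι : Type*} {l : Filter ι} {f : ι → CL X} {A : CL X} :
    Tendsto f l (𝓝 A) ↔
      (∀ U : Set X, IsOpen U → (A.1 ∩ U).Nonempty → ∀ᶠ i in l, ((f i).1 ∩ U).Nonempty) ∧
      ∀ K : Set X, IsCompact K → Disjoint A.1 K → ∀ᶠ i in l, Disjoint (f i).1 K := by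
  rw [TopologicalSpace.tendsto_nhds_generateFrom_iff]
  constructor
  · intro h
    refine ⟨fun U hU hA => h _ (Or.inl ⟨U, hU, hA.mono inter_subset_right, rfl⟩) hA,
      fun K hK hA => ?_⟩
    have hne : K ≠ univ := by
      rintro rfl
      exact A.2.1.ne_empty (disjoint_univ.1 hA)
    filter_upwards [h _ (Or.inr ⟨K, hK, hne, rfl⟩) hA.subset_compl_right] with i hi
    exact disjoint_left.2 hi
  · rintro ⟨h1, h2⟩ s (⟨U, hU, -, rfl⟩ | ⟨K, hK, -, rfl⟩) hs
    · exact h1 U hU hs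
    · filter_upwards [h2 K hK (disjoint_left.2 hs)] with i hi
      exact hi.subset_compl_right

/-- The union of two nonempty closed sets. -/
def union (A B : CL X) : CL X := ⟨A.1 ∪ B.1, A.2.1.inl, A.2.2.union B.2.2⟩

theorem tendsto_union {ι : Type*} {l : Filter ι} {f : ι → CL X} {A : CL X}
    (h : Tendsto f l (𝓝 A)) (B : CL X) :
    Tendsto (fun i => union (f i) B) l (𝓝 (union A B)) := by
  rw [tendsto_nhds_iff] at h ⊢
  refine ⟨fun U hU hA => ?_, fun K hK hA => ?_⟩
  · simp only [union, union_inter_distrib_right, union_nonempty] at hA ⊢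
    rcases hA with hA | hB
    · exact (h.1 U hU hA).mono fun i hi => Or.inl hi
    · exact Eventually.of_forall fun i => Or.inr hB
  · simp only [union, disjoint_union_left] at hA ⊢
    exact (h.2 K hK hA.1).mono fun i hi => ⟨hi, hA.2⟩

variable [T2Space X]

/-- The singleton of a point, as a closed set. -/
def single (x : X) : CL X := ⟨{x}, singleton_nonempty x, isClosed_singleton⟩

theorem nhds_eq_comap_single (x : X) : 𝓝 x = comap single (𝓝 (single x)) := by
  refine le_antisymm (tendsto_iff_comap.1 (tendsto_nhds_iff.2 ⟨fun U hU hx => ?_,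
    fun K hK hx => ?_⟩)) fun V hV => ?_
  · simp only [single, singleton_inter_nonempty] at hx ⊢
    exact hU.mem_nhds hx
  · simp only [single, disjoint_singleton_left] at hx ⊢
    exact hK.isClosed.isOpen_compl.mem_nhds hx
  · obtain ⟨U, hUV, hU, hx⟩ := mem_nhds_iff.1 hV
    have h := (tendsto_nhds_iff.1 (tendsto_id (x := 𝓝 (single x)))).1 U hU
      (singleton_inter_nonempty.2 hx)
    filter_upwards [preimage_mem_comap h] with y hy
    exact hUV (singleton_inter_nonempty.1 hy)

/-- Adding to `A` a point of its complement. -/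
def adjoin (A : CL X) (y : ↥(A.1ᶜ)) : CL X := union A (single y)

/-- `adjoin A y` contains `A`, so hit conditions are automatic and only avoidance of compact sets
counts. -/
theorem cocompact_compl_eq_comap (A : CL X) :
    cocompact ↥(A.1ᶜ) = comap (adjoin A) (𝓝 A) := by
  refine le_antisymm (tendsto_iff_comap.1 (tendsto_nhds_iff.2 ⟨fun U hU hA => ?_,
    fun K hK hA => ?_⟩)) fun V hV => ?_
  · exact Eventually.of_forall fun y => hA.mono (inter_subset_inter_left _ subset_union_left)
  · have hc : IsCompact (((↑) : ↥(A.1ᶜ) → X) ⁻¹' K) := by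
      rw [Subtype.isCompact_iff, Subtype.image_preimage_coe,
        inter_eq_right.2 hA.subset_compl_left]
      exact hK
    filter_upwards [hc.compl_mem_cocompact] with y hy
    simp only [adjoin, union, single, disjoint_union_left, disjoint_singleton_left]
    exact ⟨hA, hy⟩
  · obtain ⟨K, hK, hKV⟩ := mem_cocompact.1 hV
    have h := (tendsto_nhds_iff.1 (tendsto_id (x := 𝓝 A))).2 _ (hK.image continuous_subtype_val)
      (disjoint_right.2 (by rintro _ ⟨y, -, rfl⟩; exact y.2))
    filter_upwards [preimage_mem_comap h] with y hy
    refine hKV fun hyK => disjoint_left.1 hy ?_ (mem_image_of_mem _ hyK)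
    exact Or.inr rfl

/-- Adjoining points that leave every compact subset of `Aᶜ` makes it possible to diagonalize over
sets accumulating at `A`. -/
theorem exists_diagonal [FrechetUrysohnSpace (CL X)] {A : CL X} {p : ℕ → ↥(A.1ᶜ)}
    (hp : Tendsto p atTop (cocompact ↥(A.1ᶜ))) {S : ℕ → Set (CL X)}
    (hS : ∀ n, A ∈ closure (S n)) :
    ∃ (n : ℕ → ℕ) (C : ℕ → CL X), (∀ k, C k ∈ S (n k)) ∧ Tendsto n atTop atTop ∧
      Tendsto (fun k => union (C k) (single (p (n k)))) atTop (𝓝 A) := by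
  -- Iterated limit: `C → A` gives `A ∪ {p n}`, which tends to `A` because `p` escapes.
  have hmem : A ∈ closure {B | ∃ n, ∃ C ∈ S n, B = union C (single (p n))} := by
    rw [cocompact_compl_eq_comap, tendsto_comap_iff] at hp
    refine isClosed_closure.mem_of_tendsto hp (Eventually.of_forall fun n => ?_)
    obtain ⟨C, hC, hlim⟩ := mem_closure_iff_seq_limit.1 (hS n)
    exact mem_closure_of_tendsto (tendsto_union hlim _)
      (Eventually.of_forall fun k => ⟨n, C k, hC k, rfl⟩)
  obtain ⟨B, hB, hlim⟩ := mem_closure_iff_seq_limit.1 hmem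
  choose n C hC hBC using hB
  refine ⟨n, C, hC, tendsto_atTop.2 fun N => ?_, hlim.congr hBC⟩
  -- The tags `p i` with `i < N` form a compact set missing `A`, so they are eventually not used.
  have hfin : (((fun i => (p i : X)) '' Iio N)).Finite := (finite_Iio N).image _
  filter_upwards [(tendsto_nhds_iff.1 hlim).2 _ hfin.isCompact
    (disjoint_right.2 (by rintro _ ⟨i, -, rfl⟩; exact (p i).2))] with k hk
  by_contra! hlt
  rw [hBC] at hk
  exact disjoint_left.1 hk (Or.inr rfl) (mem_image_of_mem _ hlt)

theorem exists_seq_tendsto_cocompact [FrechetUrysohnSpace (CL X)] {A : CL X}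
    {S : Set ↥(A.1ᶜ)} (hS : ∃ᶠ y in cocompact ↥(A.1ᶜ), y ∈ S) :
    ∃ p : ℕ → ↥(A.1ᶜ), (∀ n, p n ∈ S) ∧ Tendsto p atTop (cocompact ↥(A.1ᶜ)) := by
  rw [cocompact_compl_eq_comap] at hS ⊢
  have hmem : A ∈ closure (adjoin A '' S) := by
    rw [mem_closure_iff_frequently]
    exact tendsto_comap.frequently (hS.mono fun y hy => mem_image_of_mem _ hy)
  obtain ⟨B, hB, hlim⟩ := mem_closure_iff_seq_limit.1 hmem
  choose p hp hpB using hB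
  exact ⟨p, hp, tendsto_comap_iff.2 (hlim.congr fun k => (hpB k).symm)⟩

theorem cocompact_compl_isCountablyGenerated [FrechetUrysohnSpace (CL X)]
    (hb : HasOmegaOmegaBase (CL X)) (A : CL X) :
    (cocompact ↥(A.1ᶜ)).IsCountablyGenerated := by
  rcases (cocompact ↥(A.1ᶜ)).eq_or_neBot with h | h
  · rw [h]; infer_instance
  obtain ⟨p, -, hp⟩ := exists_seq_tendsto_cocompact (A := A) (S := univ)
    (Eventually.frequently (Eventually.of_forall fun _ => trivial))
  obtain ⟨U, hU, hmono⟩ := hb A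
  have hU' := hU.comap (adjoin A)
  rw [← cocompact_compl_eq_comap] at hU'
  refine Filter.isCountablyGenerated_of_omegaOmega_basis hU'
    (fun α β h => preimage_mono (hmono α β h)) fun S hanti hS => ?_
  obtain ⟨n, C, hC, hn, hlim⟩ := exists_diagonal hp (S := fun n => adjoin A '' S n) (fun n => by
    rw [mem_closure_iff_frequently]
    have h1 := hS n
    rw [cocompact_compl_eq_comap] at h1
    exact tendsto_comap.frequently (h1.mono fun y hy => mem_image_of_mem _ hy))
  choose y hy hyC using hC
  refine ⟨y, ?_, fun m => (hn.eventually (eventually_ge_atTop m)).mono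
    fun k hk => hanti hk (hy k)⟩
  refine hasBasis_cocompact.tendsto_right_iff.2 fun K hK => ?_
  filter_upwards [(tendsto_nhds_iff.1 hlim).2 _ (hK.image continuous_subtype_val)
    (disjoint_right.2 (by rintro _ ⟨y, -, rfl⟩; exact y.2))] with k hk hyK
  rw [← hyC k] at hk
  exact disjoint_left.1 hk (Or.inl (Or.inr rfl)) (mem_image_of_mem _ hyK)

/-- If some `p` escapes compact sets of `{x}ᶜ` while staying away from `x`, its terms serve as tags
for diagonalizing at `x`. Otherwise the punctured neighborhoods of `x` form the cocompact filter of
`{x}ᶜ`. -/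
theorem firstCountable_base [FrechetUrysohnSpace (CL X)]
    (hb : HasOmegaOmegaBase (CL X)) : FirstCountableTopology X := by
  refine ⟨fun x => ?_⟩
  by_cases hex : ∃ p : ℕ → ↥((single x).1ᶜ), Tendsto p atTop (cocompact ↥((single x).1ᶜ)) ∧
      ∃ U ∈ 𝓝 x, ∀ n, (p n : X) ∉ U
  · obtain ⟨p, hp, U, hU, hpU⟩ := hex
    obtain ⟨W, hW, hmono⟩ := hb (single x)
    have hW' := hW.comap single
    rw [← nhds_eq_comap_single] at hW'
    refine Filter.isCountablyGenerated_of_omegaOmega_basis hW'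
      (fun α β h => preimage_mono (hmono α β h)) fun S hanti hS => ?_
    obtain ⟨n, C, hC, hn, hlim⟩ := exists_diagonal hp (S := fun n => single '' S n) (fun n => by
      rw [mem_closure_iff_frequently]
      have h1 := hS n
      rw [nhds_eq_comap_single] at h1
      exact tendsto_comap.frequently (h1.mono fun y hy => mem_image_of_mem _ hy))
    choose y hy hyC using hC
    refine ⟨y, ?_, fun m => (hn.eventually (eventually_ge_atTop m)).mono
      fun k hk => hanti hk (hy k)⟩
    intro V hV
    -- Since `O ⊆ U` contains no tag, the point hitting `O` is `y k`.
    obtain ⟨O, hO, hOo, hx⟩ := mem_nhds_iff.1 (inter_mem hU hV)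
    rw [mem_map]
    filter_upwards [(tendsto_nhds_iff.1 hlim).1 O hOo (singleton_inter_nonempty.2 hx)] with k hk
    rw [← hyC k] at hk
    obtain ⟨z, hz | hz, hzO⟩ := hk
    · rw [mem_singleton_iff.1 hz] at hzO
      exact (hO hzO).2
    · rw [mem_singleton_iff.1 hz] at hzO
      exact absurd (hO hzO).1 (hpU _)
  · push Not at hex
    have heq : 𝓝[≠] x = map (↑) (cocompact ↥((single x).1ᶜ)) := by
      refine le_antisymm (fun V hV => ?_) fun V hV => ?_
      · obtain ⟨K, hK, hKV⟩ := mem_cocompact.1 (mem_map.1 hV)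
        have hKc := hK.image continuous_subtype_val
        have hxK : x ∉ ((↑) : ↥((single x).1ᶜ) → X) '' K := by
          rintro ⟨y, -, hy⟩
          exact y.2 hy
        filter_upwards [self_mem_nhdsWithin,
          mem_nhdsWithin_of_mem_nhds (hKc.isClosed.isOpen_compl.mem_nhds hxK)] with z hz hzK
        exact hKV (a := (⟨z, hz⟩ : ↥((single x).1ᶜ))) fun h => hzK (mem_image_of_mem _ h)
      · obtain ⟨U, hU, hUV⟩ := mem_nhdsWithin_iff_exists_mem_nhds_inter.1 hV
        by_contra hcon
        have hfreq : ∃ᶠ y in cocompact ↥((single x).1ᶜ), y ∈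
            (((↑) : ↥((single x).1ᶜ) → X) ⁻¹' U)ᶜ := fun h =>
          hcon (mem_map.2 (by
            filter_upwards [h] with y hy
            exact hUV ⟨not_not.1 hy, y.2⟩))
        obtain ⟨p, hpU, hp⟩ := exists_seq_tendsto_cocompact hfreq
        obtain ⟨n, hn⟩ := hex p hp U hU
        exact hpU n hn
    have := cocompact_compl_isCountablyGenerated hb (single x)
    rw [← nhdsNE_sup_pure, heq]
    infer_instance

/-- Finite subsets of `A` accumulate at `A`; the union of a sequence of them converging to `A` is
dense in `A`. -/
theorem exists_countable_dense [FrechetUrysohnSpace (CL X)] (A : CL X) :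
    ∃ D : Set X, D.Countable ∧ D ⊆ A.1 ∧
      ∀ U, IsOpen U → (A.1 ∩ U).Nonempty → (D ∩ U).Nonempty := by
  have hmem : A ∈ closure {B : CL X | B.1.Finite ∧ B.1 ⊆ A.1} := by
    obtain ⟨a, ha⟩ := A.2.1
    let f : Finset ↥A.1 → CL X := fun t =>
      ⟨insert a ((↑) '' (t : Set ↥A.1)), insert_nonempty _ _,
        ((t.finite_toSet.image _).insert a).isClosed⟩
    have hfA : ∀ t, (f t).1 ⊆ A.1 := by
      intro t
      rintro _ (rfl | ⟨y, -, rfl⟩)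
      exacts [ha, y.2]
    refine mem_closure_of_tendsto (f := f) (b := atTop) (tendsto_nhds_iff.2
      ⟨fun U hU ⟨z, hzA, hzU⟩ => ?_, fun K hK hA => ?_⟩) (Eventually.of_forall fun t =>
        ⟨(t.finite_toSet.image _).insert a, hfA t⟩)
    · filter_upwards [eventually_ge_atTop ({⟨z, hzA⟩} : Finset ↥A.1)] with t ht
      exact ⟨z, Or.inr ⟨⟨z, hzA⟩, ht (Finset.mem_singleton_self _), rfl⟩, hzU⟩
    · exact Eventually.of_forall fun t => hA.mono_left (hfA t)
  obtain ⟨B, hB, hlim⟩ := mem_closure_iff_seq_limit.1 hmem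
  refine ⟨⋃ n, (B n).1, countable_iUnion fun n => (hB n).1.countable,
    iUnion_subset fun n => (hB n).2, fun U hU hA => ?_⟩
  obtain ⟨n, hn⟩ := ((tendsto_nhds_iff.1 hlim).1 U hU hA).exists
  exact hn.mono (inter_subset_inter_left _ (subset_iUnion (fun n => (B n).1) n))

theorem firstCountable [FrechetUrysohnSpace (CL X)] (hb : HasOmegaOmegaBase (CL X)) :
    FirstCountableTopology (CL X) := by
  have := firstCountable_base hb
  refine ⟨fun A => ?_⟩
  have := cocompact_compl_isCountablyGenerated hb A
  obtain ⟨D, hD, hDA, hDU⟩ := exists_countable_dense A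
  obtain ⟨K, hK, hKb⟩ := (hasBasis_cocompact (X := ↥(A.1ᶜ))).exists_antitone_subbasis
  choose V hV using fun d : X => (nhds_basis_opens d).exists_antitone_subbasis
  refine ⟨(⋃ d ∈ D, range fun i => hit (V d i)) ∪ range fun n => inside ((↑) '' K n)ᶜ,
    (hD.biUnion fun d _ => countable_range _).union (countable_range _), ?_⟩
  refine le_antisymm (le_generate_iff.2 (union_subset (iUnion₂_subset fun d hd => ?_) ?_))
    (tendsto_id'.1 (tendsto_nhds_iff.2 ⟨fun U hU hA => ?_, fun L hL hA => ?_⟩))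
  · rintro _ ⟨i, rfl⟩
    exact (tendsto_nhds_iff.1 tendsto_id).1 _ ((hV d).1 i).2 ⟨d, hDA hd, ((hV d).1 i).1⟩
  · rintro _ ⟨n, rfl⟩
    filter_upwards [(tendsto_nhds_iff.1 (tendsto_id (x := 𝓝 A))).2 _
      ((hK n).image continuous_subtype_val)
      (disjoint_right.2 (by rintro _ ⟨y, -, rfl⟩; exact y.2))] with B hB
    exact hB.subset_compl_right
  · obtain ⟨d, hd, hdU⟩ := hDU U hU hA
    obtain ⟨i, -, hi⟩ := (hV d).2.1.mem_iff.1 (hU.mem_nhds hdU)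
    refine mem_of_superset (mem_generate_of_mem (Or.inl
      (mem_iUnion₂.2 ⟨d, hd, mem_range_self i⟩))) fun B hB => ?_
    exact Set.Nonempty.mono (inter_subset_inter_right _ hi) hB
  · have hc : IsCompact (((↑) : ↥(A.1ᶜ) → X) ⁻¹' L) := by
      rw [Subtype.isCompact_iff, Subtype.image_preimage_coe,
        inter_eq_right.2 hA.subset_compl_left]
      exact hL
    obtain ⟨n, -, hn⟩ := hKb.1.mem_iff.1 hc.compl_mem_cocompact
    refine mem_of_superset (mem_generate_of_mem (Or.inr (mem_range_self n))) fun B hB => ?_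
    refine disjoint_left.2 fun z hzB hzL => hB hzB ?_
    exact ⟨⟨z, disjoint_right.1 hA hzL⟩, compl_subset_compl.1 hn hzL, rfl⟩

end CL

theorem theorem3p15 (X : Type*) [TopologicalSpace X] [T35Space X] :
    (FrechetUrysohnSpace (CL X) ∧ HasOmegaOmegaBase (CL X)) ↔
      FirstCountableTopology (CL X) := by
  constructor
  · rintro ⟨_, hb⟩
    exact CL.firstCountable hb
  · intro _
    exact ⟨inferInstance, FirstCountableTopology.hasOmegaOmegaBase _⟩
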